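/- For a class $\mathcal F$ of real functions on a set $\mathcal X$, let $R_m(\mathcal F)=\sup_{x_1,\dots,x_m\in\mathcal X}\mathbb E_{s}\big[\sup_{f\in\mathcal F}\frac1m\sum_{i=1}^m s_i f(x_i)\big]$, with $s$ uniform on $\{-1,+1\}^m$, be its Rademacher complexity on $m$ inputs from $\mathcal X$. There is a universal constant $C>0$ such that the following holds. Let $\sigma:\mathbb R\to\mathbb R$ be $L$-Lipschitz and continuously differentiable with $\mu$-Lipschitz derivative ($L,\mu\ge 0$), and let $\sigma(0)=0$. Let $n,d,m$ be natural numbers, let $b,B,\epsilon>0$ and $b_x$ be real numbers with $Bb_x\ge 2$, and let $W_0\in\mathbb R^{n\times d}$ have spectral norm $\|W_0\|\le B_0$. Let $$\mathcal F=\big\{x\mapsto u^\top\sigma(Wx)\;:\;u\in\mathbb R^n,\ W\in\mathbb R^{n\times d},\ \|u\|\le b,\ \|W-W_0\|_F\le B\big\},$$ where $\sigma$ is applied coordinatewise, $\|u\|$ is the Euclidean norm and $\|\cdot\|_F$ is the Frobenius norm. If $$m\ \ge\ \frac{C}{\epsilon^2}\,\big(1+\log m\big)^2\big(1+\log(Bb_x)\big)^2\,\Big(1+b\,b_x\big(LB_0+(\mu+L)B(1+B_0b_x)\big)\Big)^2,$$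 then the Rademacher complexity of $\mathcal F$ on $m$ inputs from $\{x\in\mathbb R^d:\|x\|\le b_x\}$ is at most $\epsilon$. In particular the condition on $m$ does not depend on $n$ and $d$. -/

import Mathlib

open scoped NNReal Matrix

namespace RademacherNN

noncomputable section

/-- The Rademacher complexity `R_m(F)` of a class `F` of real functions on the domain `X`:
the supremum over `x₁, …, x_m ∈ X` of the average, over all `2 ^ m` sign vectors `s`, of
`sup_{f ∈ F} (1 / m) ∑ i, s i * f (x i)`.
It takes values in `EReal`, so that an unbounded supremum is `⊤` and not a default value. -/
def rademacherComplexity {α : Type*} (m : ℕ) (X : Set α) (F : Set (α → ℝ)) : EReal :=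
  ⨆ x ∈ {x : Fin m → α | ∀ i, x i ∈ X},
    ((1 / 2 ^ m : ℝ) : EReal) *
      ∑ s : Fin m → ℤˣ, ⨆ f ∈ F, (((1 / m : ℝ) * ∑ i, ((s i : ℤ) : ℝ) * f (x i) : ℝ) : EReal)

/-- The Frobenius norm of a real matrix. -/
def frobeniusNorm {n d : ℕ} (W : Matrix (Fin n) (Fin d) ℝ) : ℝ :=
  Real.sqrt (∑ j, ∑ i, W j i ^ 2)

section

open scoped Matrix.Norms.L2Operator

/-- The spectral norm of a real matrix: its operator norm for the Euclidean norms. -/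
def spectralNorm {n d : ℕ} (W : Matrix (Fin n) (Fin d) ℝ) : ℝ := ‖W‖

end

/-- The class of one-hidden-layer networks `x ↦ uᵀ σ(W x) = ∑ j, u j * σ ((W x) j)` of width `n`
on `ℝ^d` with `‖u‖ ≤ b` and `‖W - W₀‖_F ≤ B`. -/
def oneHiddenLayerClass {n d : ℕ} (σ : ℝ → ℝ) (b B : ℝ) (W₀ : Matrix (Fin n) (Fin d) ℝ) :
    Set (EuclideanSpace ℝ (Fin d) → ℝ) :=
  {f | ∃ (u : EuclideanSpace ℝ (Fin n)) (W : Matrix (Fin n) (Fin d) ℝ),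
    ‖u‖ ≤ b ∧ frobeniusNorm (W - W₀) ≤ B ∧ f = fun x => ∑ j, u j * σ ((W *ᵥ x.ofLp) j)}

end

end RademacherNN

namespace RademacherNN

open Finset

/-! Subtract the network at `W₀`; that part is linear in `u`, and the vectors `σ(W₀ x)` have norm at
most `L B₀ b_x`. Write the change of neuron `j` as `‖v_j‖` times the difference quotient of `σ`
along the row increment `v_j`. By Cauchy–Schwarz `∑ |u_j| ‖v_j‖ ≤ b B`, so for each sign vector the
change is at most `b B` times the largest correlation of a single neuron's quotient
(`exists_signedSum_change_le`). The width disappears here.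

The quotients are bounded by scale. For `‖v‖ ≤ 1/R` the mean value theorem turns the correlation
into one of `σ'(⟨w', x⟩)⟨v', x⟩` with `‖v'‖ ≤ 1`, and `RadBound.mul` applies. For `‖v‖` of order `r
= 2^k/R` the factor `1/‖v‖` costs at most `2/r`, and contraction handles the two values of `σ`. Each
scale costs `O(√m R (L + μ)(1 + B₀ R))`; there are about `log₂(B R)` scales.

Averages of suprema are handled through arbitrary choices of an index for each sign vector;
`exists_envelope` returns to suprema. -/

/-- The correlation `∑ i, s i * a i` of a vector with a sign vector. -/
def signedSum {m : ℕ} (s : Fin m → ℤˣ) (a : Fin m → ℝ) : ℝ := ∑ i, ((s i : ℤ) : ℝ) * a i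

/-- Every choice `c` of an index in `T` for each sign vector has average correlation at most `K`:
the Rademacher average of the vectors `f t`, `t ∈ T`, is at most `K`. -/
def RadBound {m : ℕ} {ι : Type*} (T : Set ι) (f : ι → Fin m → ℝ) (K : ℝ) : Prop :=
  ∀ c : (Fin m → ℤˣ) → ι, (∀ s, c s ∈ T) → ∑ s, signedSum s (f (c s)) ≤ 2 ^ m * K

variable {m : ℕ} {ι : Type*}

/-! ### Sign vectors -/

section signs

theorem sign_mul_self (e : ℤˣ) : ((e : ℤ) : ℝ) * ((e : ℤ) : ℝ) = 1 := by
  rcases Int.units_eq_one_or e with h | h <;> simp [h]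

theorem abs_sign (e : ℤˣ) : |((e : ℤ) : ℝ)| = 1 := by
  rcases Int.units_eq_one_or e with h | h <;> simp [h]

theorem card_signs (m : ℕ) : (Fintype.card (Fin m → ℤˣ) : ℝ) = 2 ^ m := by
  simp

/-- Reversal of the sign at coordinate `k`. -/
def flipSign (k : Fin m) : Equiv.Perm (Fin m → ℤˣ) :=
  Function.Involutive.toPerm (fun s => Function.update s k (-s k)) (by
    intro s
    simp)

@[simp] theorem flipSign_self (k : Fin m) (s : Fin m → ℤˣ) : flipSign k s k = -s k :=
  Function.update_self ..

theorem flipSign_of_ne {k i : Fin m} (h : i ≠ k) (s : Fin m → ℤˣ) : flipSign k s i = s i :=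
  Function.update_of_ne h ..

@[simp] theorem flipSign_flipSign (k : Fin m) (s : Fin m → ℤˣ) :
    flipSign k (flipSign k s) = s := by
  ext i
  rcases eq_or_ne i k with rfl | h
  · simp
  · simp [flipSign_of_ne h]

/-- For `i ≠ j`, flipping coordinate `i` negates every term. -/
theorem sum_sign_mul_sign (i j : Fin m) :
    ∑ s : Fin m → ℤˣ, ((s i : ℤ) : ℝ) * ((s j : ℤ) : ℝ) = if i = j then 2 ^ m else 0 := by
  split_ifs with h
  · subst h
    simp only [sign_mul_self, sum_const, card_univ, nsmul_eq_mul, mul_one, card_signs]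
  · have h1 := Equiv.sum_comp (flipSign i)
      (fun s : Fin m → ℤˣ => ((s i : ℤ) : ℝ) * ((s j : ℤ) : ℝ))
    simp only [flipSign_self, flipSign_of_ne (Ne.symm h), Units.val_neg, Int.cast_neg, neg_mul,
      sum_neg_distrib] at h1
    linarith

theorem signedSum_add (s : Fin m → ℤˣ) (a b : Fin m → ℝ) :
    signedSum s (a + b) = signedSum s a + signedSum s b := by
  simp [signedSum, mul_add, sum_add_distrib]

theorem signedSum_smul (s : Fin m → ℤˣ) (r : ℝ) (a : Fin m → ℝ) :
    signedSum s (r • a) = r * signedSum s a := by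
  simp only [signedSum, Pi.smul_apply, smul_eq_mul, mul_sum]
  exact sum_congr rfl fun i _ => by ring

theorem signedSum_neg_left (s : Fin m → ℤˣ) (a : Fin m → ℝ) :
    signedSum (-s) a = -signedSum s a := by
  simp [signedSum]

theorem signedSum_neg_right (s : Fin m → ℤˣ) (a : Fin m → ℝ) :
    signedSum s (-a) = -signedSum s a := by
  simp [signedSum]

theorem signedSum_zero (s : Fin m → ℤˣ) : signedSum s (0 : Fin m → ℝ) = 0 := by
  simp [signedSum]

theorem signedSum_eq_add (k : Fin m) (s : Fin m → ℤˣ) (a : Fin m → ℝ) :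
    signedSum s a = ((s k : ℤ) : ℝ) * a k + ∑ i ∈ univ.erase k, ((s i : ℤ) : ℝ) * a i :=
  (add_sum_erase _ _ (mem_univ k)).symm

end signs

/-! ### Calculus of Rademacher averages -/

namespace RadBound

variable {T : Set ι} {f g : ι → Fin m → ℝ} {K K' : ℝ}

theorem mono (hf : RadBound T f K) (h : K ≤ K') : RadBound T f K' := fun c hc =>
  (hf c hc).trans (by gcongr)

theorem add (hf : RadBound T f K) (hg : RadBound T g K') :
    RadBound T (fun t => f t + g t) (K + K') := by
  intro c hc
  simp only [signedSum_add, sum_add_distrib, mul_add]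
  exact add_le_add (hf c hc) (hg c hc)

/-- The uniform law on sign vectors is symmetric under `s ↦ -s`. -/
theorem neg (hf : RadBound T f K) : RadBound T (fun t => -f t) K := by
  intro c hc
  have h := hf (fun s => c (-s)) (fun s => hc _)
  rw [← Equiv.sum_comp (Equiv.neg (Fin m → ℤˣ))] at h
  simp only [Equiv.neg_apply, neg_neg, signedSum_neg_left] at h
  simpa only [signedSum_neg_right] using h

theorem sub (hf : RadBound T f K) (hg : RadBound T g K') :
    RadBound T (fun t => f t - g t) (K + K') := by
  simpa only [sub_eq_add_neg] using hf.add hg.neg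

theorem smul (hf : RadBound T f K) {r : ℝ} (hr : 0 ≤ r) :
    RadBound T (fun t => r • f t) (r * K) := by
  intro c hc
  simp only [signedSum_smul, ← mul_sum]
  calc r * _ ≤ r * (2 ^ m * K) := mul_le_mul_of_nonneg_left (hf c hc) hr
    _ = _ := by ring

theorem comp {κ : Type*} {S : Set κ} (hf : RadBound T f K) {p : κ → ι}
    (hp : ∀ t ∈ S, p t ∈ T) : RadBound S (fun t => f (p t)) K :=
  fun c hc => hf (fun s => p (c s)) fun s => hp _ (hc s)

/-- If the family contains the zero vector, absolute values cost a factor of two. -/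
theorem sum_abs_le (hf : RadBound T f K) {t₀ : ι} (ht₀ : t₀ ∈ T) (hft₀ : f t₀ = 0)
    (c : (Fin m → ℤˣ) → ι) (hc : ∀ s, c s ∈ T) :
    ∑ s, |signedSum s (f (c s))| ≤ 2 ^ m * (2 * K) := by
  classical
  have key : ∀ g : ι → Fin m → ℝ, g t₀ = 0 → RadBound T g K →
      ∑ s, max (signedSum s (g (c s))) 0 ≤ 2 ^ m * K := by
    intro g hgt hg
    -- Choosing `t₀` wherever the correlation is negative realises the positive part.
    refine le_trans (sum_le_sum fun s _ => ?_)
      (hg (fun s => if 0 ≤ signedSum s (g (c s)) then c s else t₀) ?_)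
    · split_ifs with h
      · simp [h]
      · simp [hgt, signedSum_zero, (not_le.1 h).le]
    · intro s
      split_ifs
      exacts [hc s, ht₀]
  have h1 := key f hft₀ hf
  have h2 := key (fun t => -f t) (by simp [hft₀]) hf.neg
  calc ∑ s, |signedSum s (f (c s))|
      = ∑ s, max (signedSum s (f (c s))) 0 + ∑ s, max (signedSum s (-f (c s))) 0 := by
        rw [← sum_add_distrib]
        refine sum_congr rfl fun s _ => ?_
        rw [signedSum_neg_right, max_zero_add_max_neg_zero_eq_abs_self]
    _ ≤ _ := by linarith

/-- Pair `s` with its flip at `k`: coordinate `k` enters the pair's sum only through a difference of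
two values, while the other coordinates do not notice if the two chosen indices are exchanged. -/
theorem of_contraction_at (hg : RadBound T g K) (k : Fin m)
    (hk : ∀ t ∈ T, ∀ t' ∈ T, |f t k - f t' k| ≤ |g t k - g t' k|)
    (hne : ∀ t, ∀ i ≠ k, f t i = g t i) : RadBound T f K := by
  classical
  intro c hc
  -- Exchange the indices of a pair exactly when this makes the `g`-difference nonnegative.
  set c' : (Fin m → ℤˣ) → ι := fun s =>
    if 0 ≤ ((s k : ℤ) : ℝ) * (g (c s) k - g (c (flipSign k s)) k) then c s
    else c (flipSign k s) with hc'
  have hc'T : ∀ s, c' s ∈ T := by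
    intro s
    simp only [hc']
    split_ifs <;> exact hc _
  refine le_trans ?_ (hg c' hc'T)
  have hpair : ∀ F : (Fin m → ℤˣ) → ℝ, 2 * ∑ s, F s = ∑ s, (F s + F (flipSign k s)) := by
    intro F
    rw [sum_add_distrib, Equiv.sum_comp (flipSign k) F, two_mul]
  refine le_of_mul_le_mul_left ?_ (zero_lt_two (α := ℝ))
  rw [hpair, hpair]
  refine sum_le_sum fun s _ => ?_
  have hf : ∀ s t, signedSum s (f t) =
      ((s k : ℤ) : ℝ) * f t k + ∑ i ∈ univ.erase k, ((s i : ℤ) : ℝ) * g t i := by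
    intro s t
    rw [signedSum_eq_add k]
    congr 1
    exact sum_congr rfl fun i hi => by rw [hne t i (ne_of_mem_erase hi)]
  have hflip : ∀ t, ∑ i ∈ univ.erase k, ((flipSign k s i : ℤ) : ℝ) * g t i =
      ∑ i ∈ univ.erase k, ((s i : ℤ) : ℝ) * g t i := fun t =>
    sum_congr rfl fun i hi => by rw [flipSign_of_ne (ne_of_mem_erase hi)]
  have hle := hk (c s) (hc s) (c (flipSign k s)) (hc _)
  have hprod : ((s k : ℤ) : ℝ) * (f (c s) k - f (c (flipSign k s)) k) ≤
      |((s k : ℤ) : ℝ) * (g (c s) k - g (c (flipSign k s)) k)| := by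
    refine (le_abs_self _).trans ?_
    rw [abs_mul, abs_mul, abs_sign, one_mul, one_mul]
    exact hle
  simp only [hc', hf, signedSum_eq_add k _ (g _), flipSign_self, flipSign_flipSign, hflip,
    Units.val_neg, Int.cast_neg]
  have hsym : -((s k : ℤ) : ℝ) * (g (c (flipSign k s)) k - g (c s) k) =
      ((s k : ℤ) : ℝ) * (g (c s) k - g (c (flipSign k s)) k) := by ring
  rw [hsym]
  split_ifs with h
  · rw [abs_of_nonneg h] at hprod
    linarith
  · rw [abs_of_neg (not_le.1 h)] at hprod
    linarith

/-- The contraction principle of Ledoux and Talagrand. -/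
theorem of_contraction (hg : RadBound T g K)
    (h : ∀ t ∈ T, ∀ t' ∈ T, ∀ i, |f t i - f t' i| ≤ |g t i - g t' i|) : RadBound T f K := by
  classical
  -- Replace `g` by `f` one coordinate at a time.
  have key : ∀ S : Finset (Fin m), RadBound T (fun t i => if i ∈ S then f t i else g t i) K := by
    intro S
    induction S using Finset.induction_on with
    | empty => simpa using hg
    | insert k S hk ih =>
      refine ih.of_contraction_at k ?_ ?_
      · intro t ht t' ht'
        simpa [hk] using h t ht t' ht' k
      · intro t i hi
        simp [hi]
  simpa using key univ

/-- The Rademacher average of the pointwise products of two bounded families. -/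
theorem mul {a b : ℝ} (hf : RadBound T f K) (hg : RadBound T g K') (ha : 0 < a) (hb : 0 < b)
    (hfa : ∀ t ∈ T, ∀ i, |f t i| ≤ a) (hgb : ∀ t ∈ T, ∀ i, |g t i| ≤ b) :
    RadBound T (fun t => f t * g t) (2 * (b * K + a * K')) := by
  -- Polarization: `4ab·fg = (bf + ag)² - (bf - ag)²`, and squaring is `4ab`-Lipschitz on `[-2ab,
  -- 2ab]`.
  have sq : ∀ h : ι → Fin m → ℝ, RadBound T h (b * K + a * K') →
      (∀ t ∈ T, ∀ i, |h t i| ≤ 2 * (a * b)) →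
      RadBound T (fun t i => h t i ^ 2) (4 * (a * b) * (b * K + a * K')) := by
    intro h hh hbd
    refine (hh.smul (r := 4 * (a * b)) (by positivity)).of_contraction ?_
    intro t ht t' ht' i
    have h1 : h t i ^ 2 - h t' i ^ 2 = (h t i + h t' i) * (h t i - h t' i) := by ring
    have h2 : |h t i + h t' i| ≤ 4 * (a * b) :=
      (abs_add_le _ _).trans (by linarith [hbd t ht i, hbd t' ht' i])
    have h3 : (4 * (a * b)) • h t i - (4 * (a * b)) • h t' i =
      (4 * (a * b)) * (h t i - h t' i) := by simp only [smul_eq_mul]; ring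
    simp only [Pi.smul_apply]
    rw [h1, h3, abs_mul, abs_mul, abs_of_nonneg (by positivity : 0 ≤ 4 * (a * b))]
    gcongr
  have hbf : ∀ t ∈ T, ∀ i, |b * f t i| ≤ a * b := fun t ht i => by
    rw [abs_mul, abs_of_pos hb, mul_comm]
    exact mul_le_mul_of_nonneg_right (hfa t ht i) hb.le
  have hag : ∀ t ∈ T, ∀ i, |a * g t i| ≤ a * b := fun t ht i => by
    rw [abs_mul, abs_of_pos ha]
    exact mul_le_mul_of_nonneg_left (hgb t ht i) ha.le
  have h1 := sq _ ((hf.smul hb.le).add (hg.smul ha.le)) fun t ht i => by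
    have := (abs_add_le (b * f t i) (a * g t i)).trans (add_le_add (hbf t ht i) (hag t ht i))
    simpa [two_mul] using this
  have h2 := sq _ ((hf.smul hb.le).sub (hg.smul ha.le)) fun t ht i => by
    have := (abs_sub (b * f t i) (a * g t i)).trans (add_le_add (hbf t ht i) (hag t ht i))
    simpa [two_mul] using this
  have h3 := (h1.sub h2).smul (r := (4 * (a * b))⁻¹) (by positivity)
  have hab : a * b ≠ 0 := by positivity
  convert h3 using 1
  · ext t i
    simp only [Pi.mul_apply, Pi.smul_apply, Pi.add_apply, Pi.sub_apply, smul_eq_mul]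
    field_simp
    ring
  · field_simp
    ring

end RadBound

/-! ### Linear functionals -/

section linear

variable {E : Type*} [NormedAddCommGroup E] [InnerProductSpace ℝ E]

theorem sum_norm_sq_signed (a : Fin m → E) :
    ∑ s : Fin m → ℤˣ, ‖∑ i, ((s i : ℤ) : ℝ) • a i‖ ^ 2 = 2 ^ m * ∑ i, ‖a i‖ ^ 2 := by
  have h : ∀ s : Fin m → ℤˣ, ‖∑ i, ((s i : ℤ) : ℝ) • a i‖ ^ 2 =
      ∑ i, ∑ j, ((s i : ℤ) : ℝ) * ((s j : ℤ) : ℝ) * inner ℝ (a i) (a j) := by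
    intro s
    rw [← real_inner_self_eq_norm_sq]
    simp only [sum_inner, inner_sum, real_inner_smul_left, real_inner_smul_right]
    exact sum_congr rfl fun i _ => sum_congr rfl fun j _ => by
      rw [real_inner_comm]; ring
  simp only [h]
  rw [sum_comm, mul_sum]
  refine sum_congr rfl fun i _ => ?_
  rw [sum_comm]
  simp only [← sum_mul, sum_sign_mul_sign, ite_mul, zero_mul]
  simp

theorem sum_norm_signed_le (a : Fin m → E) :
    ∑ s : Fin m → ℤˣ, ‖∑ i, ((s i : ℤ) : ℝ) • a i‖ ≤ 2 ^ m * √(∑ i, ‖a i‖ ^ 2) := by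
  have h := sq_sum_le_card_mul_sum_sq (s := (univ : Finset (Fin m → ℤˣ)))
    (f := fun s => ‖∑ i, ((s i : ℤ) : ℝ) • a i‖)
  rw [sum_norm_sq_signed, card_univ, card_signs] at h
  refine abs_le_of_sq_le_sq' ?_ (by positivity) |>.2
  rw [mul_pow, Real.sq_sqrt (by positivity)]
  linarith

theorem signedSum_inner (s : Fin m → ℤˣ) (a : Fin m → E) (v : E) :
    signedSum s (fun i => inner ℝ v (a i)) = inner ℝ v (∑ i, ((s i : ℤ) : ℝ) • a i) := by
  simp [signedSum, inner_sum, real_inner_smul_right]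

theorem radBound_inner (a : Fin m → E) {r : ℝ} (hr : 0 ≤ r) :
    RadBound {v : E | ‖v‖ ≤ r} (fun v i => inner ℝ v (a i)) (r * √(∑ i, ‖a i‖ ^ 2)) := by
  intro c hc
  calc _ ≤ ∑ s : Fin m → ℤˣ, r * ‖∑ i, ((s i : ℤ) : ℝ) • a i‖ := by
        refine sum_le_sum fun s _ => ?_
        rw [signedSum_inner]
        exact (real_inner_le_norm _ _).trans
          (mul_le_mul_of_nonneg_right (hc s) (norm_nonneg _))
    _ ≤ r * (2 ^ m * √(∑ i, ‖a i‖ ^ 2)) := by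
        rw [← mul_sum]
        exact mul_le_mul_of_nonneg_left (sum_norm_signed_le a) hr
    _ = _ := by ring

theorem sqrt_sum_norm_sq_le {E : Type*} [NormedAddCommGroup E] (a : Fin m → E) {r : ℝ} (hr : 0 ≤ r) (ha : ∀ i, ‖a i‖ ≤ r) :
    √(∑ i, ‖a i‖ ^ 2) ≤ √m * r := by
  rw [Real.sqrt_le_left (by positivity), mul_pow, Real.sq_sqrt (by positivity)]
  calc ∑ i, ‖a i‖ ^ 2 ≤ ∑ _i : Fin m, r ^ 2 := by
        gcongr with i
        exact ha i
    _ = _ := by simp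

theorem radBound_inner_of_le (a : Fin m → E) {r R : ℝ} (hr : 0 ≤ r) (hR : 0 ≤ R)
    (ha : ∀ i, ‖a i‖ ≤ R) :
    RadBound {v : E | ‖v‖ ≤ r} (fun v i => inner ℝ v (a i)) (√m * (r * R)) :=
  (radBound_inner a hr).mono <| by
    have := mul_le_mul_of_nonneg_left (sqrt_sum_norm_sq_le a hR ha) hr
    linarith

end linear

/-! ### From choices to suprema -/

/-- A bound on the sums along all choices bounds the sum of the suprema. -/
theorem exists_envelope {S α : Type*} [Fintype S] {F : Set α} (hF : F.Nonempty) {φ : S → α → ℝ}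
    {K : ℝ} (h : ∀ c : S → α, (∀ s, c s ∈ F) → ∑ s, φ s (c s) ≤ K) :
    ∃ M : S → ℝ, (∀ s, ∀ f ∈ F, φ s f ≤ M s) ∧ ∑ s, M s ≤ K := by
  classical
  obtain ⟨f₀, hf₀⟩ := hF
  have hbdd : ∀ s, BddAbove (φ s '' F) := by
    intro s
    refine ⟨K - ∑ s' ∈ univ.erase s, φ s' f₀, ?_⟩
    rintro _ ⟨f, hf, rfl⟩
    -- Varying the choice at `s` alone bounds `φ s` above on `F`.
    have h1 := h (Function.update (fun _ => f₀) s f) (by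
      intro s'
      rcases eq_or_ne s' s with rfl | hs
      · simpa using hf
      · simpa [hs] using hf₀)
    rw [← add_sum_erase _ _ (mem_univ s)] at h1
    have h2 : ∑ s' ∈ univ.erase s, φ s' (Function.update (fun _ => f₀) s f s') =
        ∑ s' ∈ univ.erase s, φ s' f₀ :=
      sum_congr rfl fun s' hs' => by rw [Function.update_of_ne (ne_of_mem_erase hs')]
    rw [h2, Function.update_self] at h1
    linarith
  refine ⟨fun s => sSup (φ s '' F), fun s f hf => le_csSup (hbdd s) ⟨f, hf, rfl⟩, ?_⟩
  refine le_of_forall_pos_le_add fun δ hδ => ?_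
  have hη : 0 < δ / (Fintype.card S + 1) := by positivity
  have hex : ∀ s, ∃ f ∈ F, sSup (φ s '' F) - δ / (Fintype.card S + 1) < φ s f := by
    intro s
    obtain ⟨_, ⟨f, hf, rfl⟩, hlt⟩ := exists_lt_of_lt_csSup
      (Set.Nonempty.image (φ s) ⟨f₀, hf₀⟩) (sub_lt_self (sSup (φ s '' F)) hη)
    exact ⟨f, hf, hlt⟩
  choose c hcF hc using hex
  have h1 : ∑ s, sSup (φ s '' F) ≤ ∑ s, (φ s (c s) + δ / (Fintype.card S + 1)) :=
    sum_le_sum fun s _ => by linarith [hc s]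
  have h2 : (Fintype.card S : ℝ) * (δ / (Fintype.card S + 1)) ≤ δ := by
    rw [mul_div_assoc', div_le_iff₀ (by positivity)]
    nlinarith
  rw [sum_add_distrib, sum_const, card_univ, nsmul_eq_mul] at h1
  linarith [h c hcF]

/-- A class whose values at any `m` points of `X` have Rademacher average at most `m * ε` has
Rademacher complexity at most `ε`. -/
theorem rademacherComplexity_le {α : Type*} {X : Set α} {F : Set (α → ℝ)} (hF : F.Nonempty)
    (hm : 0 < m) {ε : ℝ}
    (h : ∀ x : Fin m → α, (∀ i, x i ∈ X) → RadBound F (fun f i => f (x i)) (m * ε)) :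
    rademacherComplexity m X F ≤ (ε : EReal) := by
  refine iSup₂_le fun x hx => ?_
  have hm' : (0 : ℝ) < m := by exact_mod_cast hm
  obtain ⟨M, hM, hsum⟩ := exists_envelope hF (K := 2 ^ m * ε)
    (φ := fun (s : Fin m → ℤˣ) f => (1 / m : ℝ) * ∑ i, ((s i : ℤ) : ℝ) * f (x i)) (by
      intro c hc
      rw [← mul_sum]
      calc _ ≤ (1 / m : ℝ) * (2 ^ m * (m * ε)) :=
            mul_le_mul_of_nonneg_left (h x hx c hc) (by positivity)
        _ = _ := by field_simp)
  have h1 : ∑ s : Fin m → ℤˣ, ⨆ f ∈ F,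
      (((1 / m : ℝ) * ∑ i, ((s i : ℤ) : ℝ) * f (x i) : ℝ) : EReal) ≤
      ((∑ s, M s : ℝ) : EReal) := by
    have hcoe : ((∑ s, M s : ℝ) : EReal) = ∑ s, (M s : EReal) := by
      exact map_sum (⟨⟨((↑) : ℝ → EReal), EReal.coe_zero⟩, EReal.coe_add⟩ : ℝ →+ EReal) _ _
    rw [hcoe]
    exact sum_le_sum fun s _ => iSup₂_le fun f hf => EReal.coe_le_coe_iff.2 (hM s f hf)
  calc _ ≤ ((1 / 2 ^ m : ℝ) : EReal) * ((∑ s, M s : ℝ) : EReal) :=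
        mul_le_mul_of_nonneg_left h1 (EReal.coe_nonneg.2 (by positivity))
    _ ≤ (ε : EReal) := by
        rw [← EReal.coe_mul, EReal.coe_le_coe_iff]
        calc _ ≤ (1 / 2 ^ m : ℝ) * (2 ^ m * ε) := by gcongr
          _ = ε := by field_simp

/-! ### Difference quotients of one neuron -/

section increments

variable {m : ℕ} {E : Type*} [NormedAddCommGroup E] [InnerProductSpace ℝ E]

/-- The values of `z ↦ (σ ⟪w + v, z⟫ - σ ⟪w, z⟫) / ‖v‖` at the points `x i`, for `p = (w, v)`. -/
noncomputable def incrementQuotient (σ : ℝ → ℝ) (x : Fin m → E) (p : E × E) (i : Fin m) : ℝ :=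
  ‖p.2‖⁻¹ * (σ (inner ℝ (p.1 + p.2) (x i)) - σ (inner ℝ p.1 (x i)))

theorem radBound_comp_inner {φ : ℝ → ℝ} {L : ℝ≥0} (hφ : LipschitzWith L φ) {x : Fin m → E}
    {r R : ℝ} (hr : 0 ≤ r) (hR : 0 ≤ R) (hx : ∀ i, ‖x i‖ ≤ R) :
    RadBound {v : E | ‖v‖ ≤ r} (fun v i => φ (inner ℝ v (x i))) (√m * (L * (r * R))) := by
  have h := (radBound_inner_of_le x hr hR hx).smul L.coe_nonneg
  refine (h.of_contraction ?_).mono (le_of_eq (by ring))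
  intro v _ v' _ i
  have h1 := hφ.dist_le_mul (inner ℝ v (x i)) (inner ℝ v' (x i))
  rw [Real.dist_eq, Real.dist_eq] at h1
  simpa only [Pi.smul_apply, smul_eq_mul, ← mul_sub, abs_mul, NNReal.abs_eq] using h1

theorem radBound_deriv_mul_inner {σ : ℝ → ℝ} {L μ : ℝ≥0} (hL : LipschitzWith L σ)
    (hμ : LipschitzWith μ (deriv σ)) {x : Fin m → E} {r R : ℝ} (hr : 0 ≤ r) (hR : 0 < R)
    (hx : ∀ i, ‖x i‖ ≤ R) :
    RadBound {q : E × E | ‖q.1‖ ≤ r ∧ ‖q.2‖ ≤ 1}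
      (fun q => (fun i => deriv σ (inner ℝ q.1 (x i))) * fun i => inner ℝ q.2 (x i))
      (2 * (√m * R * (L + μ * (r * R)))) := by
  have hder : ∀ z, |deriv σ z| ≤ L := fun z => norm_deriv_le_of_lipschitz hL
  -- `RadBound.mul` needs positive bounds; for `L = 0` the derivative vanishes.
  rcases eq_or_ne L 0 with rfl | hL0
  · have h0 : ∀ z, deriv σ z = 0 := fun z => abs_nonpos_iff.1 (by simpa using hder z)
    intro c _
    simp only [h0, signedSum, Pi.mul_apply, zero_mul, mul_zero, sum_const_zero]
    positivity
  · have h1 := (radBound_comp_inner hμ hr hR.le hx).comp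
      (S := {q : E × E | ‖q.1‖ ≤ r ∧ ‖q.2‖ ≤ 1}) (p := Prod.fst) fun q hq => hq.1
    have h2 := (radBound_inner_of_le x zero_le_one hR.le hx).comp
      (S := {q : E × E | ‖q.1‖ ≤ r ∧ ‖q.2‖ ≤ 1}) (p := Prod.snd) fun q hq => hq.2
    refine (h1.mul h2 (a := L) (b := R) (by positivity) hR (fun q _ i => hder _) ?_).mono
      (le_of_eq (by ring))
    intro q hq i
    calc |inner ℝ q.2 (x i)| ≤ ‖q.2‖ * ‖x i‖ := abs_real_inner_le_norm _ _
      _ ≤ 1 * R := mul_le_mul hq.2 (hx i) (norm_nonneg _) zero_le_one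
      _ = R := one_mul R

/-- The mean value theorem for the correlation of an increment quotient with a sign vector. -/
theorem exists_signedSum_incrementQuotient_eq {σ : ℝ → ℝ} (hσ : Differentiable ℝ σ)
    (x : Fin m → E) (s : Fin m → ℤˣ) (p : E × E) :
    ∃ q : E × E, ‖q.1‖ ≤ ‖p.1‖ + ‖p.2‖ ∧ ‖q.2‖ ≤ 1 ∧
      signedSum s (incrementQuotient σ x p) =
        signedSum s ((fun i => deriv σ (inner ℝ q.1 (x i))) * fun i => inner ℝ q.2 (x i)) := by
  obtain ⟨w, v⟩ := p
  have hd : ∀ t : ℝ, HasDerivAt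
      (fun t : ℝ => ∑ i, ((s i : ℤ) : ℝ) * σ (inner ℝ (w + t • v) (x i)))
      (∑ i, ((s i : ℤ) : ℝ) * (deriv σ (inner ℝ (w + t • v) (x i)) * inner ℝ v (x i))) t := by
    intro t
    refine HasDerivAt.fun_sum fun i _ => ?_
    refine HasDerivAt.const_mul _ ?_
    have h1 : HasDerivAt (fun t : ℝ => inner ℝ (w + t • v) (x i)) (inner ℝ v (x i)) t := by
      simp only [inner_add_left, real_inner_smul_left]
      simpa using ((hasDerivAt_id t).mul_const (inner ℝ v (x i))).const_add (inner ℝ w (x i))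
    exact (hσ _).hasDerivAt.comp t h1
  -- Applied to the whole signed sum, so that one `t` serves all sample points.
  obtain ⟨t, ht, hslope⟩ := exists_hasDerivAt_eq_slope _ _ (zero_lt_one (α := ℝ))
    (fun t _ => (hd t).continuousAt.continuousWithinAt) fun t _ => hd t
  refine ⟨(w + t • v, ‖v‖⁻¹ • v), ?_, ?_, ?_⟩
  · refine (norm_add_le _ _).trans (add_le_add le_rfl ?_)
    rw [norm_smul, Real.norm_of_nonneg ht.1.le]
    exact mul_le_of_le_one_left (norm_nonneg _) ht.2.le
  · rw [norm_smul, norm_inv, norm_norm]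
    exact inv_mul_le_one
  · calc signedSum s (incrementQuotient σ x (w, v))
        = ‖v‖⁻¹ * (∑ i, ((s i : ℤ) : ℝ) * σ (inner ℝ (w + (1 : ℝ) • v) (x i)) -
            ∑ i, ((s i : ℤ) : ℝ) * σ (inner ℝ (w + (0 : ℝ) • v) (x i))) := by
          simp only [signedSum, incrementQuotient, one_smul, zero_smul, add_zero,
            ← sum_sub_distrib, mul_sum]
          exact sum_congr rfl fun i _ => by ring
      _ = ‖v‖⁻¹ * ∑ i, ((s i : ℤ) : ℝ) *
            (deriv σ (inner ℝ (w + t • v) (x i)) * inner ℝ v (x i)) := by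
          rw [hslope, sub_zero, div_one]
      _ = _ := by
          simp only [signedSum, Pi.mul_apply, real_inner_smul_left, mul_sum]
          exact sum_congr rfl fun i _ => by ring

variable {σ : ℝ → ℝ} {L μ : ℝ≥0} {x : Fin m → E} {B₀ R : ℝ}

-- Makes `(0, 0)` the zero vector of the family, as `RadBound.sum_abs_le` and the splitting by scale
-- require.
@[simp] theorem incrementQuotient_zero_right (w : E) : incrementQuotient σ x (w, 0) = 0 := by
  ext i
  simp [incrementQuotient]

theorem sum_abs_incrementQuotient_le_of_small (hσ : Differentiable ℝ σ) (hL : LipschitzWith L σ)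
    (hμ : LipschitzWith μ (deriv σ)) (hB₀ : 0 ≤ B₀) (hR : 0 < R) (hx : ∀ i, ‖x i‖ ≤ R)
    (c : (Fin m → ℤˣ) → E × E) (hc₁ : ∀ s, ‖(c s).1‖ ≤ B₀) (hc₂ : ∀ s, ‖(c s).2‖ ≤ 1 / R) :
    ∑ s, |signedSum s (incrementQuotient σ x (c s))| ≤
      2 ^ m * (4 * (√m * R * ((L + μ) * (1 + B₀ * R)))) := by
  have hr : 0 ≤ B₀ + 1 / R := by positivity
  have h : RadBound {p : E × E | ‖p.1‖ ≤ B₀ ∧ ‖p.2‖ ≤ 1 / R} (incrementQuotient σ x)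
      (2 * (√m * R * (L + μ * ((B₀ + 1 / R) * R)))) := by
    intro c hc
    choose q hq₁ hq₂ hq using fun s => exists_signedSum_incrementQuotient_eq hσ x s (c s)
    rw [sum_congr rfl fun s _ => hq s]
    exact radBound_deriv_mul_inner hL hμ hr hR hx q fun s =>
      ⟨(hq₁ s).trans (add_le_add (hc s).1 (hc s).2), hq₂ s⟩
  refine (h.sum_abs_le (t₀ := (0, 0)) ?_ (by simp) c fun s => ⟨hc₁ s, hc₂ s⟩).trans ?_
  · simp only [Set.mem_ofPred_eq, norm_zero]
    exact ⟨hB₀, by positivity⟩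
  · have h1 : (B₀ + 1 / R) * R = 1 + B₀ * R := by field_simp; ring
    rw [h1]
    have h2 : (L : ℝ) ≤ L * (1 + B₀ * R) := le_mul_of_one_le_right L.coe_nonneg
      (le_add_of_nonneg_right (by positivity))
    have h3 : (L : ℝ) + μ * (1 + B₀ * R) ≤ (L + μ) * (1 + B₀ * R) := by linarith
    calc (2 : ℝ) ^ m * (2 * (2 * (√m * R * (L + μ * (1 + B₀ * R)))))
        ≤ 2 ^ m * (2 * (2 * (√m * R * ((L + μ) * (1 + B₀ * R))))) := by gcongr
      _ = _ := by ring

/-- The numerator has average of order `L (2 B₀ + r) R`; multiplied by `2/r ≤ R` it no longer grows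
with `r`. The lower bound on `‖v‖` is stated through the inverse, so `v = 0` is also allowed. -/
theorem sum_abs_incrementQuotient_le_of_shell (hL : LipschitzWith L σ) (hB₀ : 0 ≤ B₀)
    (hR : 0 < R) (hx : ∀ i, ‖x i‖ ≤ R) {r : ℝ} (hr : 2 / R ≤ r)
    (c : (Fin m → ℤˣ) → E × E) (hc₁ : ∀ s, ‖(c s).1‖ ≤ B₀) (hc₂ : ∀ s, ‖(c s).2‖ ≤ r)
    (hc₃ : ∀ s, ‖(c s).2‖⁻¹ ≤ 2 / r) :
    ∑ s, |signedSum s (incrementQuotient σ x (c s))| ≤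
      2 ^ m * (4 * (√m * R * (L * (1 + B₀ * R)))) := by
  have hr0 : 0 < r := lt_of_lt_of_le (by positivity) hr
  set T : Set (E × E) := {p | ‖p.1‖ ≤ B₀ ∧ ‖p.2‖ ≤ r} with hT
  have h1 := (radBound_comp_inner hL (by positivity : 0 ≤ B₀ + r) hR.le hx).comp (S := T)
    (p := fun p => p.1 + p.2) fun p hp => (norm_add_le _ _).trans (add_le_add hp.1 hp.2)
  have h2 := (radBound_comp_inner hL hB₀ hR.le hx).comp (S := T) (p := Prod.fst)
    fun p hp => hp.1
  have h3 := (h1.sub h2).sum_abs_le (t₀ := (0, 0)) (by simp [hT, hB₀, hr0.le])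
    (by simp) c fun s => ⟨hc₁ s, hc₂ s⟩
  calc ∑ s, |signedSum s (incrementQuotient σ x (c s))|
      ≤ ∑ s, 2 / r * |signedSum s ((fun i => σ (inner ℝ ((c s).1 + (c s).2) (x i))) -
          fun i => σ (inner ℝ (c s).1 (x i)))| := by
        refine sum_le_sum fun s _ => ?_
        have h4 : incrementQuotient σ x (c s) =
            ‖(c s).2‖⁻¹ • ((fun i => σ (inner ℝ ((c s).1 + (c s).2) (x i))) -
              fun i => σ (inner ℝ (c s).1 (x i))) := by
          ext i
          simp [incrementQuotient]
        rw [h4, signedSum_smul, abs_mul, abs_of_nonneg (by positivity : 0 ≤ ‖(c s).2‖⁻¹)]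
        exact mul_le_mul_of_nonneg_right (hc₃ s) (abs_nonneg _)
    _ ≤ 2 / r * (2 ^ m * (2 * (√m * (L * ((B₀ + r) * R)) + √m * (L * (B₀ * R))))) := by
        rw [← mul_sum]
        exact mul_le_mul_of_nonneg_left h3 (by positivity)
    _ = 2 ^ m * (4 * (√m * R * (L * (1 + B₀ * (2 / r))))) := by field_simp; ring
    _ ≤ _ := by
        have : 2 / r ≤ R := by
          rw [div_le_iff₀ hr0]
          rwa [div_le_iff₀ hR, mul_comm] at hr
        gcongr

/-- Each doubling of the radius adds one shell. A choice splits into its part in the inner ball and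
its part in the shell, with `(0, 0)` filling the gaps, so the costs add. -/
theorem sum_abs_incrementQuotient_le (hσ : Differentiable ℝ σ) (hL : LipschitzWith L σ)
    (hμ : LipschitzWith μ (deriv σ)) (hB₀ : 0 ≤ B₀) (hR : 0 < R) (hx : ∀ i, ‖x i‖ ≤ R)
    (N : ℕ) (c : (Fin m → ℤˣ) → E × E) (hc₁ : ∀ s, ‖(c s).1‖ ≤ B₀)
    (hc₂ : ∀ s, ‖(c s).2‖ ≤ 2 ^ N / R) :
    ∑ s, |signedSum s (incrementQuotient σ x (c s))| ≤
      2 ^ m * ((N + 1) * (4 * (√m * R * ((L + μ) * (1 + B₀ * R))))) := by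
  classical
  induction N generalizing c with
  | zero =>
    simpa using sum_abs_incrementQuotient_le_of_small hσ hL hμ hB₀ hR hx c hc₁ (by simpa using hc₂)
  | succ N ih =>
    have h1 := ih (fun s => if ‖(c s).2‖ ≤ 2 ^ N / R then c s else (0, 0))
      (fun s => by split_ifs <;> simp [hB₀, hc₁]) (fun s => by
        split_ifs with h
        · exact h
        · simp only [norm_zero]; positivity)
    have h2 := sum_abs_incrementQuotient_le_of_shell (r := 2 ^ (N + 1) / R) hL hB₀ hR hx (by
        have : (1 : ℝ) ≤ 2 ^ N := one_le_pow₀ one_le_two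
        gcongr
        rw [pow_succ]
        linarith) (fun s => if ‖(c s).2‖ ≤ 2 ^ N / R then (0, 0) else c s)
      (fun s => by split_ifs <;> simp [hB₀, hc₁]) (fun s => by
        split_ifs
        · simp only [norm_zero]; positivity
        · exact hc₂ s) (fun s => by
        have h3 : 2 / (2 ^ (N + 1) / R) = (2 ^ N / R)⁻¹ := by field_simp; ring
        rw [h3]
        split_ifs with h
        · simp only [norm_zero, inv_zero]; positivity
        · exact inv_anti₀ (by positivity) (not_le.1 h).le)
    calc _ ≤ _ := by
          refine (sum_le_sum fun s _ => ?_).trans (sum_add_distrib.trans_le (add_le_add h1 h2))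
          split_ifs <;> simp [signedSum_zero]
      _ ≤ 2 ^ m * ((N + 1) * (4 * (√m * R * ((L + μ) * (1 + B₀ * R))))) +
          2 ^ m * (4 * (√m * R * ((L + μ) * (1 + B₀ * R)))) := by
          gcongr
          exact le_add_of_nonneg_right μ.coe_nonneg
      _ = _ := by push_cast; ring

end increments

/-! ### Networks -/

section network

variable {n d m : ℕ} {σ : ℝ → ℝ} {L μ : ℝ≥0} {b B B₀ R : ℝ} {W₀ : Matrix (Fin n) (Fin d) ℝ}

/-- The `j`-th row of a matrix as a Euclidean vector. -/
def rowVec (W : Matrix (Fin n) (Fin d) ℝ) (j : Fin n) : EuclideanSpace ℝ (Fin d) :=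
  WithLp.toLp 2 (W j)

theorem mulVec_eq_inner_rowVec (W : Matrix (Fin n) (Fin d) ℝ) (j : Fin n)
    (x : EuclideanSpace ℝ (Fin d)) : (W *ᵥ x.ofLp) j = inner ℝ (rowVec W j) x := by
  simp [rowVec, Matrix.mulVec, dotProduct, PiLp.inner_apply, mul_comm]

theorem norm_mulVec_le (W : Matrix (Fin n) (Fin d) ℝ) (x : EuclideanSpace ℝ (Fin d)) :
    ‖WithLp.toLp 2 (W *ᵥ x.ofLp)‖ ≤ spectralNorm W * ‖x‖ :=
  Matrix.l2_opNorm_mulVec W x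

open scoped Matrix.Norms.L2Operator in
theorem spectralNorm_nonneg (W : Matrix (Fin n) (Fin d) ℝ) : 0 ≤ spectralNorm W :=
  norm_nonneg W

theorem norm_rowVec_le_spectralNorm (W : Matrix (Fin n) (Fin d) ℝ) (j : Fin n) :
    ‖rowVec W j‖ ≤ spectralNorm W := by
  rcases (norm_nonneg (rowVec W j)).eq_or_lt with h | h
  · rw [← h]
    exact spectralNorm_nonneg W
  · refine le_of_mul_le_mul_right ?_ h
    calc ‖rowVec W j‖ * ‖rowVec W j‖ = (W *ᵥ (rowVec W j).ofLp) j := by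
          rw [mulVec_eq_inner_rowVec, real_inner_self_eq_norm_mul_norm]
      _ ≤ ‖(WithLp.toLp 2 (W *ᵥ (rowVec W j).ofLp)) j‖ := le_abs_self _
      _ ≤ ‖WithLp.toLp 2 (W *ᵥ (rowVec W j).ofLp)‖ := PiLp.norm_apply_le _ j
      _ ≤ _ := norm_mulVec_le _ _

theorem frobeniusNorm_eq (W : Matrix (Fin n) (Fin d) ℝ) :
    frobeniusNorm W = √(∑ j, ‖rowVec W j‖ ^ 2) := by
  simp [frobeniusNorm, rowVec, EuclideanSpace.norm_sq_eq]

theorem norm_rowVec_le_frobeniusNorm (W : Matrix (Fin n) (Fin d) ℝ) (j : Fin n) :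
    ‖rowVec W j‖ ≤ frobeniusNorm W := by
  rw [frobeniusNorm_eq]
  refine Real.le_sqrt_of_sq_le ?_
  exact single_le_sum (f := fun j => ‖rowVec W j‖ ^ 2) (fun _ _ => by positivity) (mem_univ j)

theorem frobeniusNorm_zero : frobeniusNorm (0 : Matrix (Fin n) (Fin d) ℝ) = 0 := by
  simp [frobeniusNorm]

/-- The network at the initial weights of the hidden layer. -/
theorem radBound_initial (hL : LipschitzWith L σ) (hσ0 : σ 0 = 0) (hb : 0 ≤ b)
    (hR : 0 ≤ R) (hW₀ : spectralNorm W₀ ≤ B₀) {x : Fin m → EuclideanSpace ℝ (Fin d)}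
    (hx : ∀ i, ‖x i‖ ≤ R) :
    RadBound {u : EuclideanSpace ℝ (Fin n) | ‖u‖ ≤ b}
      (fun u i => ∑ j, u j * σ ((W₀ *ᵥ (x i).ofLp) j)) (√m * (b * (L * (B₀ * R)))) := by
  have hB₀ : 0 ≤ B₀ := (spectralNorm_nonneg W₀).trans hW₀
  have h := radBound_inner_of_le
    (fun i => (WithLp.toLp 2 fun j => σ ((W₀ *ᵥ (x i).ofLp) j) : EuclideanSpace ℝ (Fin n)))
    hb (R := L * (B₀ * R)) (by positivity) (by
      intro i
      have h1 : ‖(WithLp.toLp 2 fun j => σ ((W₀ *ᵥ (x i).ofLp) j) : EuclideanSpace ℝ (Fin n))‖ ≤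
          L * ‖(WithLp.toLp 2 (W₀ *ᵥ (x i).ofLp) : EuclideanSpace ℝ (Fin n))‖ := by
        refine abs_le_of_sq_le_sq' ?_ (by positivity) |>.2
        rw [mul_pow, EuclideanSpace.norm_sq_eq, EuclideanSpace.norm_sq_eq, mul_sum]
        refine sum_le_sum fun j _ => ?_
        rw [← mul_pow]
        have h2 := hL.dist_le_mul ((W₀ *ᵥ (x i).ofLp) j) 0
        rw [hσ0, dist_zero_right, dist_zero_right] at h2
        exact pow_le_pow_left₀ (norm_nonneg _) h2 2
      refine h1.trans (mul_le_mul_of_nonneg_left ?_ L.coe_nonneg)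
      exact (norm_mulVec_le _ _).trans (mul_le_mul hW₀ (hx i) (norm_nonneg _) hB₀))
  have heq : (fun (u : EuclideanSpace ℝ (Fin n)) i => ∑ j, u j * σ ((W₀ *ᵥ (x i).ofLp) j)) =
      fun u i => inner ℝ u (WithLp.toLp 2 fun j => σ ((W₀ *ᵥ (x i).ofLp) j)) := by
    ext u i
    simp [PiLp.inner_apply, mul_comm]
  rw [heq]
  exact h

/-- For each sign vector, the change of the network is dominated by that of one neuron. -/
theorem exists_signedSum_change_le (σ : ℝ → ℝ) (x : Fin m → EuclideanSpace ℝ (Fin d))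
    (hB : 0 ≤ B) (hW₀ : spectralNorm W₀ ≤ B₀)
    {W : Matrix (Fin n) (Fin d) ℝ} (hW : frobeniusNorm (W - W₀) ≤ B)
    {u : EuclideanSpace ℝ (Fin n)} (hu : ‖u‖ ≤ b) (s : Fin m → ℤˣ) :
    ∃ p : EuclideanSpace ℝ (Fin d) × EuclideanSpace ℝ (Fin d), ‖p.1‖ ≤ B₀ ∧ ‖p.2‖ ≤ B ∧
      signedSum s (fun i => ∑ j, u j * σ ((W *ᵥ (x i).ofLp) j) -
        ∑ j, u j * σ ((W₀ *ᵥ (x i).ofLp) j)) ≤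
      b * B * |signedSum s (incrementQuotient σ x p)| := by
  rcases isEmpty_or_nonempty (Fin n) with hn | hn
  · refine ⟨(0, 0), ?_, ?_, ?_⟩
    · simpa using (spectralNorm_nonneg W₀).trans hW₀
    · simpa using hB
    · simp [signedSum]
  -- The dominating neuron may depend on `s`, which a choice permits.
  · obtain ⟨k, hk⟩ := Finite.exists_max
      fun j => |signedSum s (incrementQuotient σ x (rowVec W₀ j, rowVec (W - W₀) j))|
    refine ⟨(rowVec W₀ k, rowVec (W - W₀) k), (norm_rowVec_le_spectralNorm W₀ k).trans hW₀,
      (norm_rowVec_le_frobeniusNorm _ k).trans hW, ?_⟩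
    have hrow : ∀ j, rowVec W₀ j + rowVec (W - W₀) j = rowVec W j := by
      intro j
      ext i
      simp [rowVec]
    have hj : ∀ j i, σ ((W *ᵥ (x i).ofLp) j) - σ ((W₀ *ᵥ (x i).ofLp) j) =
        ‖rowVec (W - W₀) j‖ * incrementQuotient σ x (rowVec W₀ j, rowVec (W - W₀) j) i := by
      intro j i
      simp only [mulVec_eq_inner_rowVec, incrementQuotient, hrow]
      rcases eq_or_ne (rowVec (W - W₀) j) 0 with h | h
      · have := hrow j
        rw [h, add_zero] at this
        simp [this]
      · rw [mul_inv_cancel_left₀ (norm_ne_zero_iff.2 h)]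
    have hcs : ∑ j, |u j| * ‖rowVec (W - W₀) j‖ ≤ b * B := by
      refine (Real.sum_mul_le_sqrt_mul_sqrt _ _ _).trans ?_
      rw [← frobeniusNorm_eq]
      have : √(∑ j, |u j| ^ 2) = ‖u‖ := by simp [EuclideanSpace.norm_eq]
      rw [this]
      exact mul_le_mul hu hW (Real.sqrt_nonneg _) ((norm_nonneg _).trans hu)
    calc _ = ∑ j, u j * ‖rowVec (W - W₀) j‖ *
          signedSum s (incrementQuotient σ x (rowVec W₀ j, rowVec (W - W₀) j)) := by
          simp only [signedSum, ← sum_sub_distrib, ← mul_sub, hj, mul_sum]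
          rw [sum_comm]
          exact sum_congr rfl fun j _ => sum_congr rfl fun i _ => by ring
      _ ≤ ∑ j, |u j| * ‖rowVec (W - W₀) j‖ *
          |signedSum s (incrementQuotient σ x (rowVec W₀ k, rowVec (W - W₀) k))| := by
          refine sum_le_sum fun j _ => (le_abs_self _).trans ?_
          rw [abs_mul, abs_mul, abs_norm]
          exact mul_le_mul_of_nonneg_left (hk j) (by positivity)
      _ ≤ _ := by
          rw [← sum_mul]
          exact mul_le_mul_of_nonneg_right hcs (abs_nonneg _)

theorem exists_pow_two_ge {z : ℝ} (hz : 1 ≤ z) :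
    ∃ N : ℕ, z ≤ 2 ^ N ∧ (N : ℝ) + 1 ≤ 2 * (1 + Real.log z) := by
  have hlog : 0 ≤ Real.log z := Real.log_nonneg hz
  have hlog2 := Real.log_two_gt_d9
  -- The factor two absorbs `1 / log 2 < 2`.
  refine ⟨⌈Real.logb 2 z⌉₊, ?_, ?_⟩
  · rw [← Real.rpow_natCast, ← Real.logb_le_iff_le_rpow one_lt_two (by linarith)]
    exact Nat.le_ceil _
  · have h1 := Nat.ceil_lt_add_one (Real.logb_nonneg one_lt_two hz)
    have h2 : Real.logb 2 z ≤ 2 * Real.log z := by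
      rw [Real.logb, div_le_iff₀ (by linarith)]
      nlinarith
    linarith

/-- The Rademacher average of one-hidden-layer networks near the initial weights. -/
theorem radBound_oneHiddenLayerClass (hσ : Differentiable ℝ σ) (hL : LipschitzWith L σ)
    (hμ : LipschitzWith μ (deriv σ)) (hσ0 : σ 0 = 0) (hb : 0 ≤ b) (hB : 0 < B)
    (hBR : 1 ≤ B * R) (hW₀ : spectralNorm W₀ ≤ B₀) {x : Fin m → EuclideanSpace ℝ (Fin d)}
    (hx : ∀ i, ‖x i‖ ≤ R) :
    RadBound (oneHiddenLayerClass σ b B W₀) (fun f i => f (x i))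
      (√m * (8 * (1 + Real.log (B * R)) *
        (b * R * (L * B₀ + (μ + L) * B * (1 + B₀ * R))))) := by
  have hR : 0 < R := pos_of_mul_pos_right (zero_lt_one.trans_le hBR) hB.le
  have hB₀ : 0 ≤ B₀ := (spectralNorm_nonneg W₀).trans hW₀
  obtain ⟨N, hN, hN'⟩ := exists_pow_two_ge hBR
  have hlog : 0 ≤ Real.log (B * R) := Real.log_nonneg hBR
  intro c hc
  choose u W hu hW hf using hc
  choose p hp₁ hp₂ hp using fun s => exists_signedSum_change_le σ x hB.le hW₀ (hW s) (hu s) s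
  have h1 := radBound_initial hL hσ0 hb hR.le hW₀ hx u hu
  have h2 := sum_abs_incrementQuotient_le hσ hL hμ hB₀ hR hx N p hp₁
    fun s => (hp₂ s).trans (by rwa [le_div_iff₀ hR])
  calc _ = ∑ s, (signedSum s (fun i => ∑ j, u s j * σ ((W₀ *ᵥ (x i).ofLp) j)) +
        signedSum s (fun i => ∑ j, u s j * σ ((W s *ᵥ (x i).ofLp) j) -
          ∑ j, u s j * σ ((W₀ *ᵥ (x i).ofLp) j))) := by
        refine sum_congr rfl fun s _ => ?_
        rw [← signedSum_add, hf]
        congr 1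
        ext i
        simp
    _ ≤ 2 ^ m * (√m * (b * (L * (B₀ * R)))) +
        b * B * (2 ^ m * ((N + 1) * (4 * (√m * R * ((L + μ) * (1 + B₀ * R)))))) := by
        rw [sum_add_distrib]
        refine add_le_add h1 ((sum_le_sum fun s _ => hp s).trans ?_)
        rw [← mul_sum]
        exact mul_le_mul_of_nonneg_left h2 (by positivity)
    _ ≤ 2 ^ m * (√m * ((8 * (1 + Real.log (B * R))) * (b * (L * (B₀ * R))))) +
        b * B * (2 ^ m * ((2 * (1 + Real.log (B * R))) *
          (4 * (√m * R * ((L + μ) * (1 + B₀ * R)))))) := by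
        -- The initial term is enlarged to share the logarithmic factor.
        have h3 : b * (L * (B₀ * R)) ≤
            8 * (1 + Real.log (B * R)) * (b * (L * (B₀ * R))) :=
          le_mul_of_one_le_left (by positivity) (by linarith)
        gcongr
    _ = _ := by ring

end network

end RademacherNN

/-! ### The sample size -/

theorem mainTheorem4 :
    ∃ C : ℝ, 0 < C ∧
      ∀ (n d m : ℕ) (σ : ℝ → ℝ) (L μ : ℝ≥0) (b B B₀ b_x ε : ℝ)
        (W₀ : Matrix (Fin n) (Fin d) ℝ),
        LipschitzWith L σ → ContDiff ℝ 1 σ → LipschitzWith μ (deriv σ) → σ 0 = 0 →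
        0 < b → 0 < B → 0 < ε → 2 ≤ B * b_x →
        RademacherNN.spectralNorm W₀ ≤ B₀ →
        C * ((1 + Real.log m) * (1 + Real.log (B * b_x))) ^ 2 *
            (1 + b * b_x * (L * B₀ + (μ + L) * B * (1 + B₀ * b_x))) ^ 2 / ε ^ 2 ≤ (m : ℝ) →
        RademacherNN.rademacherComplexity m
            (Metric.closedBall (0 : EuclideanSpace ℝ (Fin d)) b_x)
            (RademacherNN.oneHiddenLayerClass σ b B W₀) ≤ (ε : EReal) := by
  -- `64 = 8²`, with the `8` of `radBound_oneHiddenLayerClass`.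
  refine ⟨64, by norm_num, ?_⟩
  intro n d m σ L μ b B B₀ b_x ε W₀ hL hσ hμ hσ0 hb hB hε hBb hW₀ hm
  have hbx : 0 < b_x := pos_of_mul_pos_right (by linarith) hB.le
  have hB₀ : 0 ≤ B₀ := (RademacherNN.spectralNorm_nonneg W₀).trans hW₀
  set A := b * b_x * (L * B₀ + (μ + L) * B * (1 + B₀ * b_x)) with hA
  have hA0 : 0 ≤ A := by positivity
  set l := 1 + Real.log (B * b_x) with hl
  have hl1 : 1 ≤ l := le_add_of_nonneg_right (Real.log_nonneg (by linarith))
  set lm := 1 + Real.log m with hlm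
  have hlm1 : 1 ≤ lm := le_add_of_nonneg_right (Real.log_natCast_nonneg m)
  -- Since `Real.log 0 = 0`, the left side of `hm` is positive even for `m = 0`.
  have hmpos : 0 < m := by
    have : (0 : ℝ) < m := lt_of_lt_of_le (by positivity) hm
    exact_mod_cast this
  have hkey : 8 * l * A ≤ √m * ε := by
    calc 8 * l * A ≤ 8 * l * (1 + A) := by gcongr; linarith
      _ ≤ 8 * (lm * l) * (1 + A) := by gcongr; exact le_mul_of_one_le_left (by linarith) hlm1
      _ ≤ √m * ε := by
          refine abs_le_of_sq_le_sq' ?_ (by positivity) |>.2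
          rw [div_le_iff₀ (by positivity)] at hm
          rw [mul_pow (√m), Real.sq_sqrt (Nat.cast_nonneg m)]
          refine le_trans (le_of_eq ?_) hm
          ring
  refine RademacherNN.rademacherComplexity_le ?_ hmpos ?_
  · exact ⟨_, 0, W₀, by simpa using hb.le, by
      rw [sub_self, RademacherNN.frobeniusNorm_zero]; exact hB.le, rfl⟩
  · intro x hx
    refine (RademacherNN.radBound_oneHiddenLayerClass (hσ.differentiable one_ne_zero) hL hμ hσ0
      hb.le hB (by linarith) hW₀ (R := b_x) fun i => by simpa using hx i).mono ?_
    calc √m * (8 * l * A) ≤ √m * (√m * ε) := by gcongr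
      _ = m * ε := by rw [← mul_assoc, Real.mul_self_sqrt (Nat.cast_nonneg m)]
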